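/- Let $n\ge 1$, $\rho>0$, and let $|\cdot|$ be the Euclidean norm on $\mathbb{R}^n$. Let $V:\mathbb{R}^n\to\mathbb{R}$ be $\rho$-convex, i.e. $x\mapsto V(x)-\rho|x|^2/2$ is convex, and let $W:\mathbb{R}\to\mathbb{R}\cup\{+\infty\}$ be convex with domain $(0,+\infty)$, so that $W\equiv+\infty$ on $(-\infty,0]$ and $W<+\infty$ on $(0,+\infty)$. Put $U(x)=V(x)+\sum_{i<j}W(x_i-x_j)$, assume $Z_\mu=\int_{\mathbb{R}^n}e^{-U(x)}\,dx<\infty$, and let $\mu$ be the probability measure $\mu(dx)=Z_\mu^{-1}e^{-U(x)}\,dx$ on $\mathbb{R}^n$. Write $\|F\|_{\mathrm{Lip}}=\sup_{x\ne y}|F(x)-F(y)|/|x-y|\in[0,+\infty]$. Then: 1. For every Lipschitz $F:\mathbb{R}^n\to\mathbb{R}$, $F$ is $\mu$-integrable and, for all $r>0$, $$\mu\Big(\Big|F-\int F\,d\mu\Big|\ge r\Big)\le 2\exp\Big(-\frac{\rho}{\|F\|_{\mathrm{Lip}}^2}\frac{r^2}{2}\Big).$$ 2. For every measurable $f:\mathbb{R}\to\mathbb{R}$,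 with $L_n(f)(x)=\frac1n\sum_{i=1}^n f(x_i)$, and for all $r>0$, $$\mu\Big(\Big|L_n(f)-\int L_n(f)\,d\mu\Big|\ge r\Big)\le 2\exp\Big(-n\frac{\rho}{\|f\|_{\mathrm{Lip}}^2}\frac{r^2}{2}\Big),$$ and $L_n(f)$ is $\mu$-integrable if $\|f\|_{\mathrm{Lip}}<\infty$. 3. The first coordinate $x_1$ is $\mu$-integrable and, for all $r>0$, $$\mu\Big(\Big|x_1-\int x_1\,\mu(dx)\Big|\ge r\Big)\le 2\exp\Big(-\rho\frac{r^2}{2}\Big).$$ In these bounds the right-hand side is $0$ when the Lipschitz constant is $0$, and $2$ when it is $+\infty$ (in which case the bound is trivial, whatever meaning is given to the integral). All this holds in particular with $\rho=n$ for the beta Hermite ensemble $$d\mu(x)=\frac{e^{-\frac n2|x|^2}}{Z_\mu}\prod_{i<j}(x_i-x_j)^\beta\,\mathbf 1_{\{x_1\ge\cdots\ge x_n\}}\,dx$$ for all $\beta>0$, which is a probability measure and is the case $V(x)=\frac n2|x|^2$ ($n$-convex), $W(u)=-\beta\log u$ for $u>0$ and $W(u)=+\infty$ otherwise, with $Z_\mu<\infty$.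 -/

import Mathlib

open MeasureTheory Set
open scoped ENNReal NNReal

noncomputable section

namespace BoltzmannGibbs

/-- The admissible interaction potentials `W : ℝ → ℝ ∪ {+∞}`: convex with domain `(0, +∞)`, that is,
`W` never takes the value `-∞`, is `+∞` exactly on `(-∞, 0]`, and its restriction to `(0, +∞)`,
which is real-valued, is convex. -/
structure IsInteractionPotential (W : ℝ → EReal) : Prop where
  ne_bot : ∀ u, W u ≠ ⊥
  eq_top_iff : ∀ u, W u = ⊤ ↔ u ≤ 0
  convexOn : ConvexOn ℝ (Ioi (0 : ℝ)) (fun u => (W u).toReal)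

/-- The energy `U(x) = V(x) + ∑_{i<j} W(x_i - x_j)`, with values in `ℝ ∪ {+∞}`. -/
def energy {n : ℕ} (V : EuclideanSpace ℝ (Fin n) → ℝ) (W : ℝ → EReal)
    (x : EuclideanSpace ℝ (Fin n)) : EReal :=
  (V x : EReal) + ∑ i : Fin n, ∑ j ∈ Finset.Ioi i, W (x i - x j)

/-- The partition function `Z = ∫ e^{-U(x)} dx`, where `e^{-∞} = 0`. -/
def partitionFunction {n : ℕ} (V : EuclideanSpace ℝ (Fin n) → ℝ) (W : ℝ → EReal) : ℝ≥0∞ :=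
  ∫⁻ x, EReal.exp (-(energy V W x))

/-- The measure `μ(dx) = e^{-U(x)} / Z dx`. -/
def gibbsMeasure {n : ℕ} (V : EuclideanSpace ℝ (Fin n) → ℝ) (W : ℝ → EReal) :
    Measure (EuclideanSpace ℝ (Fin n)) :=
  (volume : Measure (EuclideanSpace ℝ (Fin n))).withDensity
    (fun x => EReal.exp (-(energy V W x)) / partitionFunction V W)

/-- `W(u) = -β log u` for `u > 0`, and `+∞` otherwise. -/
def logInteraction (β : ℝ) (u : ℝ) : EReal :=
  if 0 < u then ((-(β * Real.log u) : ℝ) : EReal) else ⊤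

/-- `V(x) = (n/2) |x|²`. -/
def hermiteConfinement (n : ℕ) (x : EuclideanSpace ℝ (Fin n)) : ℝ :=
  (n : ℝ) / 2 * ‖x‖ ^ 2

/-- The unnormalized density of the beta Hermite ensemble,
`e^{-(n/2)|x|²} ∏_{i<j} (x_i - x_j)^β 1_{x_1 ≥ ⋯ ≥ x_n}`. -/
def betaHermiteWeight (n : ℕ) (β : ℝ) : EuclideanSpace ℝ (Fin n) → ℝ≥0∞ :=
  indicator {x | ∀ i j : Fin n, i ≤ j → x j ≤ x i} fun x =>
    ENNReal.ofReal (Real.exp (-((n : ℝ) / 2 * ‖x‖ ^ 2)) *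
      ∏ i : Fin n, ∏ j ∈ Finset.Ioi i, (x i - x j) ^ β)

/-- The beta Hermite ensemble. -/
def betaHermite (n : ℕ) (β : ℝ) : Measure (EuclideanSpace ℝ (Fin n)) :=
  (volume : Measure (EuclideanSpace ℝ (Fin n))).withDensity
    (fun x => betaHermiteWeight n β x / ∫⁻ y, betaHermiteWeight n β y)

/-- `‖F‖_Lip = sup_{x ≠ y} |F(x) - F(y)| / |x - y|`, in `[0, +∞]`
(the pairs `x = y` contribute `0 / 0 = 0`). -/
def lipNorm {E : Type*} [PseudoEMetricSpace E] (F : E → ℝ) : ℝ≥0∞ :=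
  ⨆ (x : E) (y : E), edist (F x) (F y) / edist x y

/-- The quantity `2 exp (-(c / L²) (r² / 2))` for `c, r > 0` and `L ∈ [0, +∞]`; it is `0` for
`L = 0` and `2` for `L = +∞`. -/
def gaussianTail (c : ℝ) (L : ℝ≥0∞) (r : ℝ) : ℝ≥0∞ :=
  2 * EReal.exp (-((ENNReal.ofReal (c * (r ^ 2 / 2)) / L ^ 2 : ℝ≥0∞) : EReal))

/-- The linear statistics `L_n(f)(x) = (1/n) ∑ f(x_i)`. -/
def linStat {n : ℕ} (f : ℝ → ℝ) (x : EuclideanSpace ℝ (Fin n)) : ℝ :=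
  (1 / (n : ℝ)) * ∑ i : Fin n, f (x i)

/-- Gaussian concentration with rate `ρ` for a measure on `ℝⁿ`, `n ≥ 1`: for all Lipschitz
functions, for linear statistics, and for the first coordinate. The integrals around which
concentration takes place are well defined whenever the Lipschitz constant is finite. -/
structure GaussianConcentration {n : ℕ} (hn : 0 < n) (ρ : ℝ)
    (μ : Measure (EuclideanSpace ℝ (Fin n))) : Prop where
  lipschitz : ∀ F : EuclideanSpace ℝ (Fin n) → ℝ, (∃ K : ℝ≥0, LipschitzWith K F) →
    Integrable F μ ∧ ∀ r : ℝ, 0 < r →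
      μ {x | r ≤ |F x - ∫ y, F y ∂μ|} ≤ gaussianTail ρ (lipNorm F) r
  linear_statistics : ∀ f : ℝ → ℝ, Measurable f →
    (lipNorm f < ⊤ → Integrable (linStat f) μ) ∧ ∀ r : ℝ, 0 < r →
      μ {x | r ≤ |linStat f x - ∫ y, linStat f y ∂μ|} ≤ gaussianTail (n * ρ) (lipNorm f) r
  largest_particle : Integrable (fun x : EuclideanSpace ℝ (Fin n) => x ⟨0, hn⟩) μ ∧
    ∀ r : ℝ, 0 < r →
      μ {x | r ≤ |x ⟨0, hn⟩ - ∫ y, y ⟨0, hn⟩ ∂μ|} ≤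
        ENNReal.ofReal (2 * Real.exp (-(ρ * (r ^ 2 / 2))))

end BoltzmannGibbs

end

open BoltzmannGibbs

open scoped Pointwise

/-! The set where `U` is finite is the convex cone `x_1 > ⋯ > x_n`, and there each pair term is a
convex function of the linear form `x_i - x_j`. Adding the interaction therefore keeps the modulus
`ρ` of `V`, and the density `p` of `μ` is strongly log-concave
(`isStronglyLogConcave_exp_neg_energy`). Prékopa–Leindler for `p e^a`, `p e^{-b}` and `p` then
yields a Maurey inequality with weights `t + s = 1` (`IsStronglyLogConcave.maureyProperty`). For
`a`, `b` affine in a `K`-Lipschitz `F`, Jensen's inequality removes the second factor, and `s → 1`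
leaves `∫ e^F ≤ exp (∫ F + K²/(2ρ))` (`MaureyProperty.integral_exp_le`). Equal weights would lose a
factor 2 in the rate. Chernoff's bound concludes. Linear statistics gain the factor `n` because
averaging divides the Lipschitz constant by `√n`. For the beta Hermite ensemble `-log` is convex,
and `Z` is finite since the product grows at most exponentially in `|x|`. -/

/-! ### Brunn–Minkowski on the line -/

theorem volume_image_affine_real {t : ℝ} (ht : 0 < t) (d : ℝ) (K : Set ℝ) :
    volume ((fun x => t * x + d) '' K) = ENNReal.ofReal t * volume K := by
  have : (fun x => t * x + d) '' K = (fun x => x + d) '' (t • K) := by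
    rw [← image_smul, image_image]; rfl
  rw [this, image_add_right, measure_preimage_add_right, Measure.addHaar_smul]
  simp [abs_of_pos ht]

/-- With `a = max A` and `b = min B`, the copies `tA + sb` and `ta + sB` lie in `C` on either side
of `ta + sb`, so they share at most that point and their lengths add up. -/
theorem brunn_minkowski_real_of_isCompact {t s : ℝ} (ht : 0 < t) (hs : 0 < s) {A B C : Set ℝ}
    (hA : IsCompact A) (hB : IsCompact B) (hA' : A.Nonempty) (hB' : B.Nonempty)
    (h : ∀ a ∈ A, ∀ b ∈ B, t * a + s * b ∈ C) :
    ENNReal.ofReal t * volume A + ENNReal.ofReal s * volume B ≤ volume C := by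
  obtain ⟨a, ha, hmax⟩ := hA.exists_isGreatest hA'
  obtain ⟨b, hb, hmin⟩ := hB.exists_isLeast hB'
  rw [← volume_image_affine_real ht (s * b), ← volume_image_affine_real hs (t * a),
    ← measure_union₀]
  · apply measure_mono
    rintro _ (⟨x, hx, rfl⟩ | ⟨y, hy, rfl⟩)
    · exact h x hx b hb
    · simpa [add_comm] using h a ha y hy
  · exact (hB.image (by fun_prop)).measurableSet.nullMeasurableSet
  · refine measure_mono_null (t := {t * a + s * b}) ?_ (by simp)
    rintro _ ⟨⟨x, hx, rfl⟩, ⟨y, hy, hxy⟩⟩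
    have h1 := mul_le_mul_of_nonneg_left (hmax hx) ht.le
    have h2 := mul_le_mul_of_nonneg_left (hmin hy) hs.le
    simp only [mem_singleton_iff] at *
    linarith

/-- Inner regularity; the spare summand `c` lets two sets be approximated one after the other. -/
theorem mul_volume_add_le_of_forall_isCompact {t : ℝ} (ht : 0 < t) {A : Set ℝ}
    (hA : MeasurableSet A) (hA' : A.Nonempty) {c d : ℝ≥0∞}
    (h : ∀ K ⊆ A, IsCompact K → K.Nonempty → ENNReal.ofReal t * volume K + c ≤ d) :
    ENNReal.ofReal t * volume A + c ≤ d := by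
  obtain ⟨a, ha⟩ := hA'
  have hcd : c ≤ d := by
    simpa using h {a} (by simpa using ha) isCompact_singleton (singleton_nonempty a)
  by_cases hc : c = ⊤
  · rw [hc, top_le_iff] at hcd; simp [hcd]
  have ht0 : ENNReal.ofReal t ≠ 0 := by simpa using ht
  have key : volume A ≤ (d - c) / ENNReal.ofReal t := by
    refine le_of_forall_lt fun r hr => ?_
    obtain ⟨K, hKA, hK, hrK⟩ := hA.exists_lt_isCompact hr
    refine hrK.trans_le ?_
    have hne : K.Nonempty := nonempty_of_measure_ne_zero (bot_le.trans_lt hrK).ne'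
    rw [ENNReal.le_div_iff_mul_le (.inl ht0) (.inl ENNReal.ofReal_ne_top), mul_comm]
    exact ENNReal.le_sub_of_add_le_right hc (h K hKA hK hne)
  rw [ENNReal.le_div_iff_mul_le (.inl ht0) (.inl ENNReal.ofReal_ne_top), mul_comm] at key
  exact (add_le_add_left key c).trans (tsub_add_cancel_of_le hcd).le

/-- The Brunn–Minkowski inequality on the real line. -/
theorem brunn_minkowski_real {t s : ℝ} (ht : 0 < t) (hs : 0 < s) {A B C : Set ℝ}
    (hA : MeasurableSet A) (hB : MeasurableSet B) (hA' : A.Nonempty) (hB' : B.Nonempty)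
    (h : ∀ a ∈ A, ∀ b ∈ B, t * a + s * b ∈ C) :
    ENNReal.ofReal t * volume A + ENNReal.ofReal s * volume B ≤ volume C := by
  refine mul_volume_add_le_of_forall_isCompact ht hA hA' fun K hKA hK hK' => ?_
  rw [add_comm]
  refine mul_volume_add_le_of_forall_isCompact hs hB hB' fun L hLB hL hL' => ?_
  rw [add_comm]
  exact brunn_minkowski_real_of_isCompact ht hs hK hL hK' hL'
    fun a ha b hb => h a (hKA ha) b (hLB hb)

/-! ### Prékopa–Leindler -/

theorem lintegral_eq_lintegral_meas_ofReal_lt {α : Type*} [MeasurableSpace α] (μ : Measure α)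
    {f : α → ℝ≥0∞} (hf : Measurable f) (hfin : ∀ x, f x ≠ ⊤) :
    ∫⁻ x, f x ∂μ = ∫⁻ l in Ioi (0 : ℝ), μ {x | ENNReal.ofReal l < f x} := by
  have h := lintegral_eq_lintegral_meas_lt μ (f := fun x => (f x).toReal)
    (Filter.Eventually.of_forall fun x => ENNReal.toReal_nonneg) hf.ennreal_toReal.aemeasurable
  simp only [ENNReal.ofReal_toReal (hfin _)] at h
  rw [h]
  refine setLIntegral_congr_fun measurableSet_Ioi fun l hl => ?_
  simp only [ENNReal.ofReal_lt_iff_lt_toReal (le_of_lt hl) (hfin _)]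

theorem ENNReal.geom_mean_le_arith_mean {t s : ℝ} (ht : 0 < t) (hs : 0 < s) (hts : t + s = 1)
    (a b : ℝ≥0∞) : a ^ t * b ^ s ≤ ENNReal.ofReal t * a + ENNReal.ofReal s * b := by
  have ht0 : ENNReal.ofReal t ≠ 0 := by simpa using ht
  have hs0 : ENNReal.ofReal s ≠ 0 := by simpa using hs
  induction a with
  | top => simp [ENNReal.mul_top ht0]
  | coe a =>
    induction b with
    | top => simp [ENNReal.mul_top hs0]
    | coe b =>
      lift t to ℝ≥0 using ht.le
      lift s to ℝ≥0 using hs.le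
      rw [← ENNReal.coe_rpow_of_nonneg a t.coe_nonneg, ← ENNReal.coe_rpow_of_nonneg b s.coe_nonneg]
      simp only [ENNReal.ofReal_coe_nnreal]
      exact_mod_cast NNReal.geom_mean_le_arith_mean2_weighted t s a b (by exact_mod_cast hts)

/-- Brunn–Minkowski on superlevel sets, integrated over the level. Equal suprema make the level sets
of `f` and `g` nonempty for the same levels `l < 1`, and empty together beyond. -/
theorem prekopa_leindler_real_of_iSup_eq_one {t s : ℝ} (ht : 0 < t) (hs : 0 < s) (hts : t + s = 1)
    {f g h : ℝ → ℝ≥0∞} (hf : Measurable f) (hg : Measurable g) (hh : Measurable h)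
    (hf1 : ⨆ x, f x = 1) (hg1 : ⨆ x, g x = 1)
    (H : ∀ x y, f x ^ t * g y ^ s ≤ h (t * x + s * y)) :
    ENNReal.ofReal t * (∫⁻ x, f x) + ENNReal.ofReal s * (∫⁻ x, g x) ≤ ∫⁻ x, h x := by
  have hfle : ∀ x, f x ≤ 1 := fun x => hf1 ▸ le_iSup f x
  have hgle : ∀ x, g x ≤ 1 := fun x => hg1 ▸ le_iSup g x
  have hminle : ∀ x, min (h x) 1 ≤ 1 := fun x => min_le_right _ _
  have fin : ∀ {c : ℝ≥0∞}, c ≤ 1 → c ≠ ⊤ := fun hc => (hc.trans_lt ENNReal.one_lt_top).ne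
  -- Truncating `h` at 1 costs nothing and makes it finite, as the layer-cake formula needs.
  have H' : ∀ x y, f x ^ t * g y ^ s ≤ min (h (t * x + s * y)) 1 := fun x y =>
    le_min (H x y) (mul_le_one' (ENNReal.rpow_le_one (hfle x) ht.le)
      (ENNReal.rpow_le_one (hgle y) hs.le))
  refine le_trans ?_ (lintegral_mono fun x => min_le_left (h x) 1)
  rw [lintegral_eq_lintegral_meas_ofReal_lt _ hf fun x => fin (hfle x),
    lintegral_eq_lintegral_meas_ofReal_lt _ hg fun x => fin (hgle x),
    lintegral_eq_lintegral_meas_ofReal_lt _ (hh.min measurable_const) fun x => fin (hminle x)]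
  refine (add_le_add (lintegral_const_mul_le _ _) (lintegral_const_mul_le _ _)).trans
    ((le_lintegral_add _ _).trans (setLIntegral_mono' measurableSet_Ioi fun l hl => ?_))
  rcases lt_or_ge l 1 with hl1 | hl1
  · have hl1' : ENNReal.ofReal l < 1 := by simpa using hl1
    obtain ⟨x₀, hx₀⟩ := lt_iSup_iff.1 (hl1'.trans_eq hf1.symm)
    obtain ⟨y₀, hy₀⟩ := lt_iSup_iff.1 (hl1'.trans_eq hg1.symm)
    refine brunn_minkowski_real ht hs (measurableSet_lt measurable_const hf)
      (measurableSet_lt measurable_const hg) ⟨x₀, hx₀⟩ ⟨y₀, hy₀⟩ fun a ha b hb =>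
        lt_of_lt_of_le ?_ (H' a b)
    have hl0 : ENNReal.ofReal l ≠ 0 := by simpa using hl
    calc ENNReal.ofReal l = ENNReal.ofReal l ^ t * ENNReal.ofReal l ^ s := by
          rw [← ENNReal.rpow_add _ _ hl0 ENNReal.ofReal_ne_top, hts, ENNReal.rpow_one]
      _ < f a ^ t * g b ^ s :=
          ENNReal.mul_lt_mul (ENNReal.rpow_lt_rpow ha ht) (ENNReal.rpow_lt_rpow hb hs)
  · have hl1' : 1 ≤ ENNReal.ofReal l := by simpa using hl1
    simp [fun x => ((hfle x).trans hl1').not_gt, fun x => ((hgle x).trans hl1').not_gt]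

theorem prekopa_leindler_real_of_le {t s : ℝ} (ht : 0 < t) (hs : 0 < s) (hts : t + s = 1)
    {f g h : ℝ → ℝ≥0∞} (hf : Measurable f) (hg : Measurable g) (hh : Measurable h)
    {k : ℝ≥0∞} (hk : k ≠ ⊤) (hfk : ∀ x, f x ≤ k) (hgk : ∀ x, g x ≤ k)
    (H : ∀ x y, f x ^ t * g y ^ s ≤ h (t * x + s * y)) :
    (∫⁻ x, f x) ^ t * (∫⁻ x, g x) ^ s ≤ ∫⁻ x, h x := by
  set M := ⨆ x, f x with hM
  set N := ⨆ x, g x with hN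
  have hMt : M ≠ ⊤ := ((iSup_le hfk).trans_lt hk.lt_top).ne
  have hNt : N ≠ ⊤ := ((iSup_le hgk).trans_lt hk.lt_top).ne
  by_cases hM0 : M = 0
  · have : ∀ x, f x = 0 := by simpa [hM] using hM0
    simp [this, ht]
  by_cases hN0 : N = 0
  · have : ∀ x, g x = 0 := by simpa [hN] using hN0
    simp [this, hs]
  have hP0 : M ^ t * N ^ s ≠ 0 := by simp [hM0, hN0, hMt, hNt]
  have hPt : M ^ t * N ^ s ≠ ⊤ := by finiteness
  -- Both sides of the hypothesis scale by `M ^ t * N ^ s`, so `f` and `g` may be normalised to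
  -- supremum 1.
  have key := prekopa_leindler_real_of_iSup_eq_one ht hs hts (f := fun x => M⁻¹ * f x)
    (g := fun x => N⁻¹ * g x) (h := fun x => (M ^ t * N ^ s)⁻¹ * h x) (hf.const_mul _)
    (hg.const_mul _) (hh.const_mul _)
    (by rw [← ENNReal.mul_iSup]; exact ENNReal.inv_mul_cancel hM0 hMt)
    (by rw [← ENNReal.mul_iSup]; exact ENNReal.inv_mul_cancel hN0 hNt) (by
      intro x y
      rw [ENNReal.mul_rpow_of_nonneg _ _ ht.le, ENNReal.mul_rpow_of_nonneg _ _ hs.le,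
        mul_mul_mul_comm, ENNReal.inv_rpow, ENNReal.inv_rpow,
        ENNReal.mul_inv (.inr (by finiteness)) (.inl (by finiteness))]
      gcongr
      exact H x y)
  have key2 := (ENNReal.geom_mean_le_arith_mean ht hs hts _ _).trans key
  rw [lintegral_const_mul _ hf, lintegral_const_mul _ hg, lintegral_const_mul _ hh,
    ENNReal.mul_rpow_of_nonneg _ _ ht.le, ENNReal.mul_rpow_of_nonneg _ _ hs.le,
    mul_mul_mul_comm, ENNReal.inv_rpow, ENNReal.inv_rpow,
    ← ENNReal.mul_inv (.inr (by finiteness)) (.inl (by finiteness))] at key2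
  exact (ENNReal.mul_le_mul_iff_right (ENNReal.inv_ne_zero.2 hPt) (ENNReal.inv_ne_top.2 hP0)).1 key2

theorem tendsto_lintegral_min_nat {α : Type*} [MeasurableSpace α] (μ : Measure α)
    {f : α → ℝ≥0∞} (hf : Measurable f) :
    Filter.Tendsto (fun k : ℕ => ∫⁻ x, min (f x) k ∂μ) Filter.atTop (nhds (∫⁻ x, f x ∂μ)) := by
  refine lintegral_tendsto_of_tendsto_of_monotone
    (fun k => (hf.min measurable_const).aemeasurable)
    (Filter.Eventually.of_forall fun x k l hkl => min_le_min_left _ (by exact_mod_cast hkl))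
    (Filter.Eventually.of_forall fun x => ?_)
  simpa using (tendsto_const_nhds (x := f x)).min ENNReal.tendsto_nat_nhds_top

/-- The Prékopa–Leindler inequality on the real line. -/
theorem prekopa_leindler_real {t s : ℝ} (ht : 0 < t) (hs : 0 < s) (hts : t + s = 1)
    {f g h : ℝ → ℝ≥0∞} (hf : Measurable f) (hg : Measurable g) (hh : Measurable h)
    (H : ∀ x y, f x ^ t * g y ^ s ≤ h (t * x + s * y)) :
    (∫⁻ x, f x) ^ t * (∫⁻ x, g x) ^ s ≤ ∫⁻ x, h x := by
  -- Vanishing integrals are set aside because multiplication is not continuous at `0 · ∞`.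
  by_cases hf0 : ∫⁻ x, f x = 0
  · simp [hf0, ht]
  by_cases hg0 : ∫⁻ x, g x = 0
  · simp [hg0, hs]
  refine le_of_tendsto (ENNReal.Tendsto.mul
    ((ENNReal.continuous_rpow_const.tendsto _).comp (tendsto_lintegral_min_nat volume hf)) (.inl ?_)
    ((ENNReal.continuous_rpow_const.tendsto _).comp (tendsto_lintegral_min_nat volume hg))
    (.inl ?_)) (Filter.Eventually.of_forall fun k => ?_)
  · simp [hf0, ht.not_gt]
  · simp [hg0, hs.not_gt]
  · refine prekopa_leindler_real_of_le ht hs hts (hf.min measurable_const)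
      (hg.min measurable_const) hh (ENNReal.natCast_ne_top k) (fun x => min_le_right _ _)
      (fun x => min_le_right _ _) fun x y => le_trans ?_ (H x y)
    gcongr <;> exact min_le_left _ _

/-- The Prékopa–Leindler inequality on `Fin n → ℝ`. -/
theorem prekopa_leindler_pi {t s : ℝ} (ht : 0 < t) (hs : 0 < s) (hts : t + s = 1) (n : ℕ)
    {f g h : (Fin n → ℝ) → ℝ≥0∞} (hf : Measurable f) (hg : Measurable g) (hh : Measurable h)
    (H : ∀ x y, f x ^ t * g y ^ s ≤ h (t • x + s • y)) :
    (∫⁻ x, f x) ^ t * (∫⁻ x, g x) ^ s ≤ ∫⁻ x, h x := by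
  induction n with
  | zero =>
    have hv : volume (univ : Set (Fin 0 → ℝ)) = 1 := by simp [volume_pi]
    simp only [lintegral_unique, hv, mul_one]
    exact (H _ _).trans_eq (congrArg h (Subsingleton.elim _ _))
  | succ n ih =>
    set e := MeasurableEquiv.piFinSuccAbove (fun _ : Fin (n + 1) => ℝ) 0
    have he : MeasurePreserving e.symm :=
      (volume_preserving_piFinSuccAbove (fun _ : Fin (n + 1) => ℝ) 0).symm
    have fubini : ∀ {u : (Fin (n + 1) → ℝ) → ℝ≥0∞}, Measurable u →
        ∫⁻ x, u x = ∫⁻ a, ∫⁻ z, u (e.symm (a, z)) := fun {u} hu => by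
      rw [← he.lintegral_comp hu, Measure.volume_eq_prod]
      exact lintegral_prod _ (hu.comp e.symm.measurable).aemeasurable
    have slice : ∀ {u : (Fin (n + 1) → ℝ) → ℝ≥0∞}, Measurable u → ∀ a,
        Measurable fun z => u (e.symm (a, z)) := fun hu a =>
      hu.comp (e.symm.measurable.comp measurable_prodMk_left)
    have marg : ∀ {u : (Fin (n + 1) → ℝ) → ℝ≥0∞}, Measurable u →
        Measurable fun a => ∫⁻ z, u (e.symm (a, z)) := fun hu =>
      (hu.comp e.symm.measurable).lintegral_prod_right'
    rw [fubini hf, fubini hg, fubini hh]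
    -- Induction on dimension: the inequality for slices says exactly that the marginals satisfy the
    -- one-dimensional hypothesis.
    refine prekopa_leindler_real ht hs hts (marg hf) (marg hg) (marg hh) fun a b =>
      ih (slice hf a) (slice hg b) (slice hh _) fun x y => (H _ _).trans_eq ?_
    congr 1
    ext i
    refine Fin.cases ?_ (fun j => ?_) i <;> simp [e]

/-- The Prékopa–Leindler inequality on Euclidean space. -/
theorem prekopa_leindler {t s : ℝ} (ht : 0 < t) (hs : 0 < s) (hts : t + s = 1) {n : ℕ}
    {f g h : EuclideanSpace ℝ (Fin n) → ℝ≥0∞} (hf : Measurable f) (hg : Measurable g)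
    (hh : Measurable h) (H : ∀ x y, f x ^ t * g y ^ s ≤ h (t • x + s • y)) :
    (∫⁻ x, f x) ^ t * (∫⁻ x, g x) ^ s ≤ ∫⁻ x, h x := by
  have he := PiLp.volume_preserving_toLp (Fin n)
  rw [← he.lintegral_comp hf, ← he.lintegral_comp hg, ← he.lintegral_comp hh]
  exact prekopa_leindler_pi ht hs hts n (hf.comp he.measurable) (hg.comp he.measurable)
    (hh.comp he.measurable) fun x y => H _ _

/-! ### From strong log-concavity to the Maurey inequality -/

/-- `p` is log-concave with modulus `ρ`: formally, `-log p` is `ρ`-convex. -/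
def IsStronglyLogConcave {n : ℕ} (ρ : ℝ) (p : EuclideanSpace ℝ (Fin n) → ℝ≥0∞) : Prop :=
  ∀ ⦃t s : ℝ⦄, 0 < t → 0 < s → t + s = 1 → ∀ x y,
    p x ^ t * p y ^ s * ENNReal.ofReal (Real.exp (ρ * t * s / 2 * ‖x - y‖ ^ 2)) ≤
      p (t • x + s • y)

/-- The weighted Maurey property: an exponential inequality for pairs of functions whose weighted
difference is controlled by a quadratic cost. -/
def MaureyProperty {n : ℕ} (ρ : ℝ) (μ : Measure (EuclideanSpace ℝ (Fin n))) : Prop :=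
  ∀ ⦃t s : ℝ⦄, 0 < t → 0 < s → t + s = 1 → ∀ ⦃a b : EuclideanSpace ℝ (Fin n) → ℝ⦄,
    Measurable a → Measurable b →
    (∀ x y, t * a x - s * b y ≤ ρ * t * s / 2 * ‖x - y‖ ^ 2) →
    (∫⁻ x, ENNReal.ofReal (Real.exp (a x)) ∂μ) ^ t *
      (∫⁻ x, ENNReal.ofReal (Real.exp (-b x)) ∂μ) ^ s ≤ 1

section

variable {n : ℕ} {ρ : ℝ}

theorem ENNReal.ofReal_exp_rpow (u t : ℝ) :
    ENNReal.ofReal (Real.exp u) ^ t = ENNReal.ofReal (Real.exp (t * u)) := by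
  rw [ENNReal.ofReal_rpow_of_pos (Real.exp_pos u), ← Real.exp_mul, mul_comm]

theorem IsStronglyLogConcave.div_const {p : EuclideanSpace ℝ (Fin n) → ℝ≥0∞}
    (hp : IsStronglyLogConcave ρ p) {c : ℝ≥0∞} (hc0 : c ≠ 0) (hc : c ≠ ⊤) :
    IsStronglyLogConcave ρ fun x => p x / c := by
  intro t s ht hs hts x y
  have h1 : c⁻¹ ^ t * c⁻¹ ^ s = c⁻¹ := by
    rw [← ENNReal.rpow_add _ _ (ENNReal.inv_ne_zero.2 hc) (ENNReal.inv_ne_top.2 hc0), hts,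
      ENNReal.rpow_one]
  simp only [div_eq_mul_inv]
  rw [ENNReal.mul_rpow_of_nonneg _ _ ht.le, ENNReal.mul_rpow_of_nonneg _ _ hs.le,
    mul_mul_mul_comm, h1, mul_right_comm]
  gcongr
  exact hp ht hs hts x y

theorem IsStronglyLogConcave.maureyProperty {p : EuclideanSpace ℝ (Fin n) → ℝ≥0∞}
    (hp : IsStronglyLogConcave ρ p) (hm : Measurable p) (h1 : ∫⁻ x, p x = 1) :
    MaureyProperty ρ (volume.withDensity p) := by
  intro t s ht hs hts a b ha hb hab
  have ha' : Measurable fun x => ENNReal.ofReal (Real.exp (a x)) := by fun_prop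
  have hb' : Measurable fun x => ENNReal.ofReal (Real.exp (-b x)) := by fun_prop
  rw [lintegral_withDensity_eq_lintegral_mul _ hm ha',
    lintegral_withDensity_eq_lintegral_mul _ hm hb', ← h1]
  -- The cost bound on `t a - s b` is exactly what the modulus of log-concavity of `p` absorbs.
  refine prekopa_leindler ht hs hts (hm.mul ha') (hm.mul hb') hm fun x y =>
    le_trans ?_ (hp ht hs hts x y)
  simp only [Pi.mul_apply]
  rw [ENNReal.mul_rpow_of_nonneg _ _ ht.le, ENNReal.mul_rpow_of_nonneg _ _ hs.le,
    mul_mul_mul_comm, ENNReal.ofReal_exp_rpow, ENNReal.ofReal_exp_rpow,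
    ← ENNReal.ofReal_mul (Real.exp_pos _).le, ← Real.exp_add]
  gcongr
  linarith [hab x y]

/-! ### Laplace transforms and Gaussian tails -/

variable {μ : Measure (EuclideanSpace ℝ (Fin n))} {K : ℝ≥0}
  {F : EuclideanSpace ℝ (Fin n) → ℝ}

/-- The choice `b = (t/s) F` turns `t a - s b` into `t` times an increment of `F`, up to a constant.
That constant is the least allowing `K d ≤ K²/(2ρs) + ρ s d²/2` for all `d`. -/
theorem MaureyProperty.lintegral_lipschitz (hμ : MaureyProperty ρ μ) (hρ : 0 < ρ)
    (hF : LipschitzWith K F) {t s : ℝ} (ht : 0 < t) (hs : 0 < s) (hts : t + s = 1) :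
    (∫⁻ x, ENNReal.ofReal (Real.exp (F x - K ^ 2 / (2 * ρ * s))) ∂μ) ^ t *
      (∫⁻ x, ENNReal.ofReal (Real.exp (-(t / s * F x))) ∂μ) ^ s ≤ 1 := by
  have hFm : Measurable F := hF.continuous.measurable
  refine hμ ht hs hts (by fun_prop) (by fun_prop) fun x y => ?_
  have h1 : F x - F y ≤ K * ‖x - y‖ := by
    have := hF.dist_le_mul x y
    rw [dist_eq_norm, dist_eq_norm] at this
    exact (le_abs_self _).trans this
  have h2 : K * ‖x - y‖ ≤ K ^ 2 / (2 * ρ * s) + ρ * s / 2 * ‖x - y‖ ^ 2 := by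
    have : K ^ 2 / (2 * ρ * s) + ρ * s / 2 * ‖x - y‖ ^ 2 - K * ‖x - y‖ =
        (K - ρ * s * ‖x - y‖) ^ 2 / (2 * ρ * s) := by
      field_simp
      ring
    have h3 : 0 ≤ (K - ρ * s * ‖x - y‖) ^ 2 / (2 * ρ * s) := by positivity
    linarith
  have h4 : t * (F x - K ^ 2 / (2 * ρ * s)) - s * (t / s * F y) =
      t * (F x - F y - K ^ 2 / (2 * ρ * s)) := by
    field_simp
    ring
  rw [h4]
  nlinarith

variable [IsProbabilityMeasure μ]

/-- At `t = s = 1/2` the second factor is positive, so the first cannot be infinite. -/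
theorem MaureyProperty.integrable_exp (hμ : MaureyProperty ρ μ) (hρ : 0 < ρ)
    (hF : LipschitzWith K F) : Integrable (fun x => Real.exp (F x)) μ := by
  -- The shift cancels the constant subtracted in the Maurey bound, leaving `∫ e^F` itself.
  have hF' : LipschitzWith K fun x => F x + K ^ 2 / (2 * ρ * (1 / 2)) := by
    simpa using hF.add (LipschitzWith.const (K ^ 2 / (2 * ρ * (1 / 2)) : ℝ))
  have h := hμ.lintegral_lipschitz hρ hF' (t := 1 / 2) (s := 1 / 2) (by norm_num) (by norm_num)
    (by norm_num)
  simp only [add_sub_cancel_right] at h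
  have hm := hF'.continuous.measurable
  refine ⟨(Real.continuous_exp.comp hF.continuous).aestronglyMeasurable, ?_⟩
  rw [hasFiniteIntegral_iff_ofReal (Filter.Eventually.of_forall fun x => (Real.exp_pos _).le),
    lt_top_iff_ne_top]
  intro htop
  rw [htop, ENNReal.top_rpow_of_pos (by norm_num), ENNReal.top_mul] at h
  · simp at h
  · intro h0
    rw [ENNReal.rpow_eq_zero_iff_of_pos (by norm_num),
      lintegral_eq_zero_iff (by fun_prop)] at h0
    obtain ⟨x, hx⟩ := h0.exists
    simp [(Real.exp_pos _).not_ge] at hx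

theorem MaureyProperty.integrable_of_lipschitzWith (hμ : MaureyProperty ρ μ) (hρ : 0 < ρ)
    (hF : LipschitzWith K F) : Integrable F μ := by
  have h : LipschitzWith K fun x => |F x| := by
    simpa [Function.comp_def] using lipschitzWith_one_norm.comp hF
  refine (hμ.integrable_exp hρ h).mono' hF.continuous.aestronglyMeasurable
    (Filter.Eventually.of_forall fun x => ?_)
  rw [Real.norm_eq_abs]
  linarith [Real.add_one_le_exp |F x|]

theorem MaureyProperty.integral_exp_le_of_lt_one (hμ : MaureyProperty ρ μ) (hρ : 0 < ρ)
    (hF : LipschitzWith K F) {s : ℝ} (hs : 0 < s) (hs1 : s < 1) :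
    ∫ x, Real.exp (F x) ∂μ ≤ Real.exp (∫ x, F x ∂μ + K ^ 2 / (2 * ρ * s)) := by
  set t := 1 - s with ht_def
  set m := ∫ x, F x ∂μ
  set c : ℝ := K ^ 2 / (2 * ρ * s)
  have ht : 0 < t := by linarith
  have h := hμ.lintegral_lipschitz hρ hF ht hs (by linarith)
  have hFi := hμ.integrable_of_lipschitzWith hρ hF
  have hG : LipschitzWith (‖-(t / s)‖₊ * K) fun x => -(t / s * F x) := by
    simpa [Function.comp_def] using (lipschitzWith_smul (-(t / s))).comp hF
  have hGi := hμ.integrable_exp hρ hG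
  have jensen : Real.exp (-(t / s) * m) ≤ ∫ x, Real.exp (-(t / s * F x)) ∂μ := by
    have := convexOn_exp.map_integral_le (μ := μ) (f := fun x => -(t / s * F x))
      Real.continuous_exp.continuousOn isClosed_univ (by simp) (hFi.const_mul _).neg hGi
    rwa [integral_neg, integral_const_mul, ← neg_mul] at this
  have hE : Integrable (fun x => Real.exp (F x - c)) μ := by
    simpa only [sub_eq_add_neg, Real.exp_add] using (hμ.integrable_exp hρ hF).mul_const _
  have hEeq : ∫ x, Real.exp (F x - c) ∂μ = (∫ x, Real.exp (F x) ∂μ) * Real.exp (-c) := by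
    simp only [sub_eq_add_neg, Real.exp_add]
    rw [integral_mul_const]
  rw [← ofReal_integral_eq_lintegral_ofReal hE
      (Filter.Eventually.of_forall fun x => (Real.exp_pos _).le),
    ← ofReal_integral_eq_lintegral_ofReal hGi
      (Filter.Eventually.of_forall fun x => (Real.exp_pos _).le)] at h
  -- By Jensen the second factor is at least `e^{-tm}`; both factors are now powers `t`, and the
  -- root can be taken before `t → 0`.
  have h2 : ENNReal.ofReal (∫ x, Real.exp (F x - c) ∂μ) ^ t *
      ENNReal.ofReal (Real.exp (-m)) ^ t ≤ 1 := by
    refine le_trans ?_ h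
    refine mul_le_mul_right ?_ _
    rw [ENNReal.ofReal_exp_rpow]
    calc ENNReal.ofReal (Real.exp (t * -m))
        = ENNReal.ofReal (Real.exp (-(t / s) * m)) ^ s := by
          rw [ENNReal.ofReal_exp_rpow]
          congr 2
          field_simp
      _ ≤ _ := by gcongr
  rw [← ENNReal.mul_rpow_of_nonneg _ _ ht.le, ← ENNReal.one_rpow t, ENNReal.rpow_le_rpow_iff ht,
    ← ENNReal.ofReal_mul (by positivity), ENNReal.ofReal_le_one, hEeq, mul_assoc,
    ← Real.exp_add] at h2
  have h3 := mul_le_mul_of_nonneg_right h2 (Real.exp_pos (m + c)).le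
  rwa [mul_assoc, ← Real.exp_add, show -c + -m + (m + c) = 0 by ring, Real.exp_zero, mul_one,
    one_mul] at h3

theorem MaureyProperty.integral_exp_le (hμ : MaureyProperty ρ μ) (hρ : 0 < ρ)
    (hF : LipschitzWith K F) :
    ∫ x, Real.exp (F x) ∂μ ≤ Real.exp (∫ x, F x ∂μ + K ^ 2 / (2 * ρ)) := by
  have hlim : Filter.Tendsto (fun s : ℝ => Real.exp (∫ x, F x ∂μ + K ^ 2 / (2 * ρ * s)))
      (nhdsWithin 1 (Iio 1)) (nhds (Real.exp (∫ x, F x ∂μ + K ^ 2 / (2 * ρ)))) := by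
    have : ContinuousAt (fun s : ℝ => Real.exp (∫ x, F x ∂μ + K ^ 2 / (2 * ρ * s))) 1 := by
      fun_prop (disch := positivity)
    simpa [ContinuousAt] using this.tendsto.mono_left nhdsWithin_le_nhds
  refine ge_of_tendsto hlim ?_
  filter_upwards [Ioo_mem_nhdsLT (zero_lt_one' ℝ)] with s hs
  exact hμ.integral_exp_le_of_lt_one hρ hF hs.1 hs.2

theorem MaureyProperty.hasSubgaussianMGF (hμ : MaureyProperty ρ μ) (hρ : 0 < ρ)
    (hF : LipschitzWith K F) :
    ProbabilityTheory.HasSubgaussianMGF (fun x => F x - ∫ y, F y ∂μ) (K ^ 2 / ρ.toNNReal) μ := by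
  have hG : ∀ u : ℝ, LipschitzWith (‖u‖₊ * K) fun x => u * (F x - ∫ y, F y ∂μ) := fun u => by
    simpa [Function.comp_def] using
      (lipschitzWith_smul u).comp (hF.sub (LipschitzWith.const (∫ y, F y ∂μ)))
  refine ⟨fun u => hμ.integrable_exp hρ (hG u), fun u => ?_⟩
  refine (hμ.integral_exp_le hρ (hG u)).trans_eq ?_
  -- The centred function has mean zero, and `|u| K` in place of `K` gives `u² K² / (2ρ)`.
  rw [integral_const_mul, integral_sub (hμ.integrable_of_lipschitzWith hρ hF) (by simp)]
  simp [hρ.le, mul_pow]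
  ring

theorem gaussianTail_coe {c r : ℝ} (hc : 0 ≤ c) (hK : K ≠ 0) :
    gaussianTail c K r = 2 * ENNReal.ofReal (Real.exp (-(c * (r ^ 2 / 2) / K ^ 2))) := by
  have hK' : (0 : ℝ) < K := by exact_mod_cast pos_iff_ne_zero.2 hK
  have : ENNReal.ofReal (c * (r ^ 2 / 2)) / (K : ℝ≥0∞) ^ 2 =
      ENNReal.ofReal (c * (r ^ 2 / 2) / K ^ 2) := by
    rw [ENNReal.ofReal_div_of_pos (by positivity), ENNReal.ofReal_pow hK'.le,
      ENNReal.ofReal_coe_nnreal]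
  rw [gaussianTail, this, EReal.coe_ennreal_ofReal, max_eq_left (by positivity),
    ← EReal.coe_neg, EReal.exp_coe]

/-- Gaussian concentration of Lipschitz functions around their mean. -/
theorem MaureyProperty.measure_abs_sub_le (hμ : MaureyProperty ρ μ) (hρ : 0 < ρ)
    (hF : LipschitzWith K F) {r : ℝ} (hr : 0 < r) :
    μ {x | r ≤ |F x - ∫ y, F y ∂μ|} ≤ gaussianTail ρ K r := by
  -- For `K = 0` real division would give the exponent 0; but then `F` is constant and the event is
  -- empty.
  by_cases hK : K = 0
  · subst hK
    have hconst : ∀ x, F x = F 0 := fun x => by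
      simpa using hF.edist_le_mul x 0
    simp [hconst, hr.not_ge]
  have hK' : (0 : ℝ) < K := by exact_mod_cast pos_iff_ne_zero.2 hK
  have hsub := hμ.hasSubgaussianMGF hρ hF
  have hexp : -r ^ 2 / (2 * ((K ^ 2 / ρ.toNNReal : ℝ≥0) : ℝ)) = -(ρ * (r ^ 2 / 2) / K ^ 2) := by
    simp only [NNReal.coe_div, NNReal.coe_pow, Real.coe_toNNReal _ hρ.le]
    field_simp
  have h1 := hsub.measure_ge_le hr.le
  have h2 := hsub.neg.measure_ge_le hr.le
  rw [hexp] at h1 h2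
  have hsplit : {x | r ≤ |F x - ∫ y, F y ∂μ|} ⊆ {x | r ≤ F x - ∫ y, F y ∂μ} ∪
      {x | r ≤ (-fun x => F x - ∫ y, F y ∂μ) x} := fun x (hx : r ≤ |F x - ∫ y, F y ∂μ|) =>
    le_abs.1 hx
  rw [gaussianTail_coe hρ.le hK, two_mul]
  refine (measure_mono hsplit).trans ((measure_union_le _ _).trans (add_le_add ?_ ?_))
  · exact (ENNReal.le_ofReal_iff_toReal_le (measure_ne_top _ _) (Real.exp_pos _).le).2 h1
  · exact (ENNReal.le_ofReal_iff_toReal_le (measure_ne_top _ _) (Real.exp_pos _).le).2 h2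

end

/-! ### Optimal Lipschitz constants and linear statistics -/

theorem lipschitzWith_lipNorm_toNNReal {E : Type*} [MetricSpace E] {F : E → ℝ}
    (hF : lipNorm F ≠ ⊤) : LipschitzWith (lipNorm F).toNNReal F := by
  intro x y
  rw [ENNReal.coe_toNNReal hF]
  rcases eq_or_ne x y with rfl | hxy
  · simp
  · rw [← ENNReal.div_le_iff (by simpa using hxy) (edist_ne_top x y)]
    exact le_iSup₂_of_le (f := fun x y => edist (F x) (F y) / edist x y) x y le_rfl

theorem LipschitzWith.lipNorm_le {E : Type*} [PseudoEMetricSpace E] {K : ℝ≥0} {F : E → ℝ}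
    (hF : LipschitzWith K F) : lipNorm F ≤ K :=
  iSup₂_le fun x y => ENNReal.div_le_of_le_mul (hF x y)

theorem lipschitzWith_linStat {n : ℕ} (hn : 0 < n) {f : ℝ → ℝ} {K : ℝ≥0}
    (hf : LipschitzWith K f) :
    LipschitzWith (K / NNReal.sqrt n) (linStat f : EuclideanSpace ℝ (Fin n) → ℝ) := by
  have hn' : (0 : ℝ) < n := by exact_mod_cast hn
  refine LipschitzWith.of_dist_le_mul fun x y => ?_
  -- Cauchy–Schwarz, the source of the gain `1/√n`.
  have h1 : ∑ i, |x i - y i| ≤ √n * dist x y := by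
    rw [EuclideanSpace.dist_eq, ← Real.sqrt_mul hn'.le]
    refine Real.le_sqrt_of_sq_le ?_
    have := sq_sum_le_card_mul_sum_sq (s := Finset.univ) (f := fun i => |x i - y i|)
    simpa [Real.dist_eq] using this
  have h2 : |∑ i, f (x i) - ∑ i, f (y i)| ≤ K * ∑ i, |x i - y i| := by
    rw [← Finset.sum_sub_distrib, Finset.mul_sum]
    exact (Finset.abs_sum_le_sum_abs _ _).trans
      (Finset.sum_le_sum fun i _ => by simpa [Real.dist_eq] using hf.dist_le_mul (x i) (y i))
  have h3 : dist (linStat f x) (linStat f y) = 1 / n * |∑ i, f (x i) - ∑ i, f (y i)| := by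
    rw [linStat, linStat, Real.dist_eq, ← mul_sub, abs_mul, abs_of_pos (by positivity)]
  rw [h3]
  calc 1 / (n : ℝ) * |∑ i, f (x i) - ∑ i, f (y i)| ≤ 1 / n * (K * (√n * dist x y)) := by
        gcongr
        exact h2.trans (by gcongr)
    _ = _ := by
        have := Real.mul_self_sqrt hn'.le
        simp only [NNReal.coe_div, Real.coe_sqrt, NNReal.coe_natCast]
        field_simp
        linear_combination (K * dist x y) * this

theorem gaussianTail_zero {c r : ℝ} (hc : 0 < c) (hr : 0 < r) : gaussianTail c 0 r = 0 := by
  have : ENNReal.ofReal (c * (r ^ 2 / 2)) ≠ 0 := by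
    simp only [ne_eq, ENNReal.ofReal_eq_zero, not_le]
    positivity
  simp [gaussianTail, ENNReal.div_zero this]

theorem gaussianTail_div_sqrt {n : ℕ} (hn : 0 < n) {ρ r : ℝ} (hρ : 0 < ρ) (hr : 0 < r) (K : ℝ≥0) :
    gaussianTail ρ (K / NNReal.sqrt n : ℝ≥0) r = gaussianTail (n * ρ) K r := by
  have hn' : (0 : ℝ) < n := by exact_mod_cast hn
  by_cases hK : K = 0
  · simp [hK, gaussianTail_zero hρ hr, gaussianTail_zero (mul_pos hn' hρ) hr]
  have hK' : (0 : ℝ) < K := by exact_mod_cast pos_iff_ne_zero.2 hK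
  rw [gaussianTail_coe hρ.le (by simp [hK, hn.ne']), gaussianTail_coe (by positivity) hK]
  congr 4
  simp only [NNReal.coe_div, Real.coe_sqrt, NNReal.coe_natCast, div_pow, Real.sq_sqrt hn'.le]
  field_simp

theorem MaureyProperty.gaussianConcentration {n : ℕ} (hn : 0 < n) {ρ : ℝ} (hρ : 0 < ρ)
    {μ : Measure (EuclideanSpace ℝ (Fin n))} [IsProbabilityMeasure μ] (hμ : MaureyProperty ρ μ) :
    GaussianConcentration hn ρ μ where
  lipschitz F := by
    rintro ⟨K, hK⟩
    have hL : lipNorm F ≠ ⊤ := (hK.lipNorm_le.trans_lt ENNReal.coe_lt_top).ne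
    refine ⟨hμ.integrable_of_lipschitzWith hρ hK, fun r hr => ?_⟩
    simpa [ENNReal.coe_toNNReal hL] using
      hμ.measure_abs_sub_le hρ (lipschitzWith_lipNorm_toNNReal hL) hr
  linear_statistics f _ := by
    refine ⟨fun hL => hμ.integrable_of_lipschitzWith hρ
      (lipschitzWith_linStat hn (lipschitzWith_lipNorm_toNNReal hL.ne)), fun r hr => ?_⟩
    -- Here the bound is 2, above any probability.
    by_cases hL : lipNorm f = ⊤
    · refine prob_le_one.trans ?_
      simp [gaussianTail, hL]
    · have := hμ.measure_abs_sub_le hρ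
        (lipschitzWith_linStat hn (lipschitzWith_lipNorm_toNNReal hL)) hr
      rwa [gaussianTail_div_sqrt hn hρ hr, ENNReal.coe_toNNReal hL] at this
  largest_particle := by
    have hF : LipschitzWith 1 fun x : EuclideanSpace ℝ (Fin n) => x ⟨0, hn⟩ :=
      LipschitzWith.of_dist_le_mul fun x y => by
        simpa [dist_eq_norm] using PiLp.norm_apply_le (x - y) ⟨0, hn⟩
    refine ⟨hμ.integrable_of_lipschitzWith hρ hF, fun r hr => ?_⟩
    refine (hμ.measure_abs_sub_le hρ hF hr).trans_eq ?_
    rw [gaussianTail_coe hρ.le one_ne_zero, ENNReal.ofReal_mul zero_le_two]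
    simp

/-! ### Convexity of the energy and the Gibbs measure -/

theorem EReal.coe_finsetSum {ι : Type*} (s : Finset ι) (f : ι → ℝ) :
    ((∑ i ∈ s, f i : ℝ) : EReal) = ∑ i ∈ s, (f i : EReal) := by
  classical
  induction s using Finset.induction_on with
  | empty => simp
  | insert i s hi ih => rw [Finset.sum_insert hi, Finset.sum_insert hi, EReal.coe_add, ih]

theorem EReal.finsetSum_ne_bot {ι : Type*} (s : Finset ι) {f : ι → EReal}
    (hf : ∀ i ∈ s, f i ≠ ⊥) : ∑ i ∈ s, f i ≠ ⊥ :=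
  Finset.sum_induction f (· ≠ ⊥) (fun _ _ ha hb => EReal.add_ne_bot_iff.2 ⟨ha, hb⟩)
    EReal.zero_ne_bot hf

/-- Excluding `⊥` is essential, since `⊤ + ⊥ = ⊥` in `EReal`. -/
theorem EReal.finsetSum_eq_top {ι : Type*} (s : Finset ι) {f : ι → EReal}
    (hf : ∀ i ∈ s, f i ≠ ⊥) {i : ι} (hi : i ∈ s) (htop : f i = ⊤) : ∑ i ∈ s, f i = ⊤ := by
  classical
  rw [← Finset.add_sum_erase s f hi, htop]
  exact EReal.top_add_of_ne_bot
    (EReal.finsetSum_ne_bot _ fun j hj => hf j (Finset.mem_of_mem_erase hj))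

/-- The open Weyl chamber `x_1 > ⋯ > x_n`. -/
def weylChamber (n : ℕ) : Set (EuclideanSpace ℝ (Fin n)) :=
  {x | ∀ i j : Fin n, i < j → x j < x i}

/-- The energy as a real number, meaningful on the Weyl chamber. -/
noncomputable def realEnergy {n : ℕ} (V : EuclideanSpace ℝ (Fin n) → ℝ) (W : ℝ → EReal)
    (x : EuclideanSpace ℝ (Fin n)) : ℝ :=
  V x + ∑ i : Fin n, ∑ j ∈ Finset.Ioi i, (W (x i - x j)).toReal

section

variable {n : ℕ} {V : EuclideanSpace ℝ (Fin n) → ℝ} {W : ℝ → EReal}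
  {x y : EuclideanSpace ℝ (Fin n)}

theorem isOpen_weylChamber (n : ℕ) : IsOpen (weylChamber n) := by
  simp only [weylChamber, ofPred_forall]
  refine isOpen_iInter_of_finite fun i => isOpen_iInter_of_finite fun j =>
    isOpen_iInter_of_finite fun _ => isOpen_lt (by fun_prop) (by fun_prop)

theorem weylChamber_nonempty (n : ℕ) : (weylChamber n).Nonempty :=
  ⟨WithLp.toLp 2 fun i => -(i : ℝ), fun i j hij => by simpa using hij⟩

theorem convex_weylChamber (n : ℕ) : Convex ℝ (weylChamber n) := by
  intro x hx y hy a b ha hb hab i j hij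
  have h1 := hx i j hij
  have h2 := hy i j hij
  simp only [PiLp.add_apply, PiLp.smul_apply, smul_eq_mul]
  rcases ha.eq_or_lt with rfl | ha
  · simp_all
  · nlinarith [mul_lt_mul_of_pos_left h1 ha, mul_le_mul_of_nonneg_left h2.le hb]

theorem BoltzmannGibbs.IsInteractionPotential.coe_toReal (hW : IsInteractionPotential W) {u : ℝ}
    (hu : 0 < u) : ((W u).toReal : EReal) = W u :=
  EReal.coe_toReal (fun h => hu.not_ge ((hW.eq_top_iff u).1 h)) (hW.ne_bot u)

theorem energy_of_mem (hW : IsInteractionPotential W) (hx : x ∈ weylChamber n) :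
    energy V W x = (realEnergy V W x : EReal) := by
  rw [realEnergy, EReal.coe_add, EReal.coe_finsetSum, energy]
  congr 1
  refine Finset.sum_congr rfl fun i _ => ?_
  rw [EReal.coe_finsetSum]
  refine Finset.sum_congr rfl fun j hj => ?_
  rw [hW.coe_toReal (sub_pos.2 (hx i j (Finset.mem_Ioi.1 hj)))]

theorem energy_of_notMem (hW : IsInteractionPotential W) (hx : x ∉ weylChamber n) :
    energy V W x = ⊤ := by
  simp only [weylChamber, mem_ofPred_eq, not_forall, not_lt] at hx
  obtain ⟨i, j, hij, hle⟩ := hx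
  rw [energy, EReal.finsetSum_eq_top Finset.univ (f := fun i => ∑ j ∈ Finset.Ioi i, W (x i - x j))
    (fun i _ => EReal.finsetSum_ne_bot _ fun j _ => hW.ne_bot _) (Finset.mem_univ i)
    (EReal.finsetSum_eq_top _ (fun j _ => hW.ne_bot _) (Finset.mem_Ioi.2 hij)
      ((hW.eq_top_iff _).2 (sub_nonpos.2 hle)))]
  exact EReal.coe_add_top _

theorem exp_neg_energy_of_mem (hW : IsInteractionPotential W) (hx : x ∈ weylChamber n) :
    EReal.exp (-(energy V W x)) = ENNReal.ofReal (Real.exp (-(realEnergy V W x))) := by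
  rw [energy_of_mem hW hx, ← EReal.coe_neg, EReal.exp_coe]

theorem exp_neg_energy_of_notMem (hW : IsInteractionPotential W) (hx : x ∉ weylChamber n) :
    EReal.exp (-(energy V W x)) = 0 := by
  simp [energy_of_notMem hW hx]

/-- A convex function on an open interval is continuous, so the density is continuous on the open
chamber and zero elsewhere. -/
theorem measurable_exp_neg_energy (hV : Continuous V) (hW : IsInteractionPotential W) :
    Measurable fun x => EReal.exp (-(energy V W x)) := by
  classical
  have hWc : ContinuousOn (fun u => (W u).toReal) (Ioi 0) := hW.convexOn.continuousOn isOpen_Ioi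
  have hU : ContinuousOn (realEnergy V W) (weylChamber n) := by
    refine hV.continuousOn.add (continuousOn_finsetSum _ fun i _ => continuousOn_finsetSum _
      fun j hj => hWc.comp (by fun_prop) fun x hx => ?_)
    exact sub_pos.2 (hx i j (Finset.mem_Ioi.1 hj))
  have h : (fun x => EReal.exp (-(energy V W x))) = (weylChamber n).piecewise
      (fun x => ENNReal.ofReal (Real.exp (-(realEnergy V W x)))) (fun _ => 0) := by
    ext x
    by_cases hx : x ∈ weylChamber n
    · rw [piecewise_eq_of_mem _ _ _ hx, exp_neg_energy_of_mem hW hx]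
    · rw [piecewise_eq_of_notMem _ _ _ hx, exp_neg_energy_of_notMem hW hx]
  rw [h]
  exact ContinuousOn.measurable_piecewise
    (ENNReal.continuous_ofReal.comp_continuousOn (Real.continuous_exp.comp_continuousOn hU.neg))
    continuousOn_const (isOpen_weylChamber n).measurableSet

theorem realEnergy_le {ρ : ℝ} (hV : StrongConvexOn univ ρ V) (hW : IsInteractionPotential W)
    (hx : x ∈ weylChamber n) (hy : y ∈ weylChamber n) {t s : ℝ} (ht : 0 ≤ t) (hs : 0 ≤ s)
    (hts : t + s = 1) :
    realEnergy V W (t • x + s • y) ≤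
      t * realEnergy V W x + s * realEnergy V W y - ρ * t * s / 2 * ‖x - y‖ ^ 2 := by
  have h1 := hV.2 (mem_univ x) (mem_univ y) ht hs hts
  have h2 : ∑ i : Fin n, ∑ j ∈ Finset.Ioi i, (W ((t • x + s • y) i - (t • x + s • y) j)).toReal ≤
      ∑ i : Fin n, ∑ j ∈ Finset.Ioi i,
        (t * (W (x i - x j)).toReal + s * (W (y i - y j)).toReal) := by
    refine Finset.sum_le_sum fun i _ => Finset.sum_le_sum fun j hj => ?_
    have hij := Finset.mem_Ioi.1 hj
    have := hW.convexOn.2 (sub_pos.2 (hx i j hij)) (sub_pos.2 (hy i j hij)) ht hs hts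
    simp only [smul_eq_mul] at this
    convert this using 3
    simp only [PiLp.add_apply, PiLp.smul_apply, smul_eq_mul]
    ring
  simp only [Finset.sum_add_distrib, ← Finset.mul_sum] at h2
  simp only [smul_eq_mul] at h1
  simp only [realEnergy]
  linarith

theorem isStronglyLogConcave_exp_neg_energy {ρ : ℝ} (hV : StrongConvexOn univ ρ V)
    (hW : IsInteractionPotential W) :
    IsStronglyLogConcave ρ fun x => EReal.exp (-(energy V W x)) := by
  intro t s ht hs hts x y
  dsimp only
  by_cases hx : x ∈ weylChamber n
  -- If either point leaves the chamber, its density is 0 with a positive exponent, and the left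
  -- side vanishes.
  · by_cases hy : y ∈ weylChamber n
    · rw [exp_neg_energy_of_mem hW hx, exp_neg_energy_of_mem hW hy,
        exp_neg_energy_of_mem hW (convex_weylChamber n hx hy ht.le hs.le hts),
        ENNReal.ofReal_exp_rpow, ENNReal.ofReal_exp_rpow, ← ENNReal.ofReal_mul (Real.exp_pos _).le,
        ← ENNReal.ofReal_mul (by positivity), ← Real.exp_add, ← Real.exp_add]
      gcongr
      linarith [realEnergy_le hV hW hx hy ht.le hs.le hts]
    · simp [exp_neg_energy_of_notMem hW hy, hs]
  · simp [exp_neg_energy_of_notMem hW hx, ht]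

theorem StrongConvexOn.continuous {ρ : ℝ} (hρ : 0 ≤ ρ) (hV : StrongConvexOn univ ρ V) :
    Continuous V := by
  have h : ConvexOn ℝ univ V := UniformConvexOn.convexOn hV fun r => by positivity
  simpa [continuousOn_univ] using h.continuousOn isOpen_univ

theorem partitionFunction_ne_zero (hV : Continuous V) (hW : IsInteractionPotential W) :
    partitionFunction V W ≠ 0 := by
  rw [partitionFunction, ne_eq, lintegral_eq_zero_iff (measurable_exp_neg_energy hV hW)]
  intro h
  have hpos := (isOpen_weylChamber n).measure_pos volume (weylChamber_nonempty n)
  refine hpos.ne' (measure_mono_null (fun x hx => ?_) h)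
  simp [energy_of_mem hW hx]

theorem isProbabilityMeasure_gibbsMeasure (hV : Continuous V) (hW : IsInteractionPotential W)
    (hZ : partitionFunction V W < ⊤) : IsProbabilityMeasure (gibbsMeasure V W) := by
  refine ⟨?_⟩
  simp only [gibbsMeasure, withDensity_apply _ MeasurableSet.univ, Measure.restrict_univ,
    div_eq_mul_inv]
  rw [lintegral_mul_const _ (measurable_exp_neg_energy hV hW)]
  exact ENNReal.mul_inv_cancel (partitionFunction_ne_zero hV hW) hZ.ne

theorem maureyProperty_gibbsMeasure {ρ : ℝ} (hρ : 0 ≤ ρ) (hV : StrongConvexOn univ ρ V)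
    (hW : IsInteractionPotential W) (hZ : partitionFunction V W < ⊤) :
    MaureyProperty ρ (gibbsMeasure V W) := by
  have hm := measurable_exp_neg_energy (hV.continuous hρ) hW
  have h0 := partitionFunction_ne_zero (hV.continuous hρ) hW
  refine ((isStronglyLogConcave_exp_neg_energy hV hW).div_const h0 hZ.ne).maureyProperty
    (hm.div_const _) ?_
  simp only [div_eq_mul_inv]
  rw [lintegral_mul_const _ hm]
  exact ENNReal.mul_inv_cancel h0 hZ.ne

end

/-! ### The beta Hermite ensemble -/

theorem strongConvexOn_hermiteConfinement (n : ℕ) :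
    StrongConvexOn univ (n : ℝ) (hermiteConfinement n) := by
  rw [strongConvexOn_iff_convex]
  simpa [hermiteConfinement] using convexOn_const (0 : ℝ) convex_univ

theorem isInteractionPotential_logInteraction {β : ℝ} (hβ : 0 < β) :
    IsInteractionPotential (logInteraction β) where
  ne_bot u := by
    unfold logInteraction
    split_ifs
    · exact EReal.coe_ne_bot _
    · exact top_ne_bot
  eq_top_iff u := by
    unfold logInteraction
    split_ifs with h
    · exact iff_of_false (EReal.coe_ne_top _) h.not_ge
    · simpa using h
  convexOn := by
    refine ((strictConcaveOn_log_Ioi.concaveOn.smul hβ.le).neg).congr fun u hu => ?_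
    simp only [logInteraction, if_pos (mem_Ioi.1 hu), EReal.toReal_coe]
    rfl

section

variable {n : ℕ} {β : ℝ}

theorem exp_neg_realEnergy_hermite {x : EuclideanSpace ℝ (Fin n)} (hx : x ∈ weylChamber n) :
    Real.exp (-(realEnergy (hermiteConfinement n) (logInteraction β) x)) =
      Real.exp (-((n : ℝ) / 2 * ‖x‖ ^ 2)) *
        ∏ i : Fin n, ∏ j ∈ Finset.Ioi i, (x i - x j) ^ β := by
  rw [realEnergy, hermiteConfinement, neg_add, Real.exp_add, ← Finset.sum_neg_distrib,
    Real.exp_sum]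
  congr 1
  refine Finset.prod_congr rfl fun i _ => ?_
  rw [← Finset.sum_neg_distrib, Real.exp_sum]
  refine Finset.prod_congr rfl fun j hj => ?_
  have h : 0 < x i - x j := sub_pos.2 (hx i j (Finset.mem_Ioi.1 hj))
  rw [logInteraction, if_pos h, EReal.toReal_coe, neg_neg, Real.rpow_def_of_pos h, mul_comm]

theorem betaHermiteWeight_eq (hβ : 0 < β) (x : EuclideanSpace ℝ (Fin n)) :
    betaHermiteWeight n β x =
      EReal.exp (-(energy (hermiteConfinement n) (logInteraction β) x)) := by
  have hW := isInteractionPotential_logInteraction hβ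
  by_cases hx : x ∈ weylChamber n
  · rw [exp_neg_energy_of_mem hW hx, exp_neg_realEnergy_hermite hx, betaHermiteWeight,
      indicator_of_mem]
    intro i j hij
    rcases hij.eq_or_lt with rfl | hij
    · exact le_rfl
    · exact (hx i j hij).le
  · rw [exp_neg_energy_of_notMem hW hx, betaHermiteWeight, indicator_apply_eq_zero]
    intro hx'
    simp only [weylChamber, mem_ofPred_eq, not_forall, not_lt] at hx
    obtain ⟨i, j, hij, hle⟩ := hx
    -- Weakly but not strictly ordered coordinates include a tie, where `β > 0` makes the product
    -- vanish; the two densities agree on the boundary too.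
    have heq : x i - x j = 0 := sub_eq_zero.2 (le_antisymm hle (hx' i j hij.le))
    rw [Finset.prod_eq_zero (Finset.mem_univ i) (Finset.prod_eq_zero (Finset.mem_Ioi.2 hij)
      (by rw [heq, Real.zero_rpow hβ.ne'])), mul_zero, ENNReal.ofReal_zero]

theorem gibbsMeasure_hermite_eq (hβ : 0 < β) :
    gibbsMeasure (hermiteConfinement n) (logInteraction β) = betaHermite n β := by
  simp only [gibbsMeasure, betaHermite, partitionFunction, betaHermiteWeight_eq hβ]

/-- From `log u ≤ u` and `x_i - x_j ≤ 2|x|`, each factor is at most `e^{2β|x|}`. -/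
theorem prod_rpow_sub_le (hβ : 0 ≤ β) {x : EuclideanSpace ℝ (Fin n)} (hx : x ∈ weylChamber n) :
    ∏ i : Fin n, ∏ j ∈ Finset.Ioi i, (x i - x j) ^ β ≤
      Real.exp ((∑ i : Fin n, ∑ _j ∈ Finset.Ioi i, 2 * β) * ‖x‖) := by
  rw [Finset.sum_mul, Real.exp_sum]
  have hpos : ∀ i, ∀ j ∈ Finset.Ioi i, 0 < x i - x j := fun i j hj =>
    sub_pos.2 (hx i j (Finset.mem_Ioi.1 hj))
  refine Finset.prod_le_prod
    (fun i _ => Finset.prod_nonneg fun j hj => Real.rpow_nonneg (hpos i j hj).le _) fun i _ => ?_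
  rw [Finset.sum_mul, Real.exp_sum]
  refine Finset.prod_le_prod (fun j hj => Real.rpow_nonneg (hpos i j hj).le _) fun j hj => ?_
  rw [Real.rpow_def_of_pos (hpos i j hj)]
  have h1 := (Real.log_le_sub_one_of_pos (hpos i j hj)).trans (sub_le_self _ zero_le_one)
  have h2 := (le_abs_self _).trans (PiLp.norm_apply_le x i)
  have h3 := (neg_le_abs _).trans (PiLp.norm_apply_le x j)
  refine Real.exp_le_exp.2 ?_
  nlinarith [mul_le_mul_of_nonneg_right (h1.trans (by linarith : x i - x j ≤ 2 * ‖x‖)) hβ]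

theorem integrable_exp_neg_mul_norm_sq {E : Type*} [NormedAddCommGroup E] [InnerProductSpace ℝ E]
    [FiniteDimensional ℝ E] [MeasurableSpace E] [BorelSpace E] {c : ℝ} (hc : 0 < c) :
    Integrable fun x : E => Real.exp (-c * ‖x‖ ^ 2) := by
  have h := (GaussianFourier.integrable_cexp_neg_mul_sq_norm_add (V := E) (b := c) (by simpa) 0 0).re
  refine h.congr (Filter.Eventually.of_forall fun x => ?_)
  simp only [zero_mul, add_zero]
  norm_cast

theorem partitionFunction_hermite_lt_top (hn : 0 < n) (hβ : 0 < β) :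
    partitionFunction (hermiteConfinement n) (logInteraction β) < ⊤ := by
  have hn' : (0 : ℝ) < n := by exact_mod_cast hn
  have hW := isInteractionPotential_logInteraction hβ
  set C : ℝ := ∑ i : Fin n, ∑ _j ∈ Finset.Ioi i, 2 * β
  have hint : Integrable fun x : EuclideanSpace ℝ (Fin n) =>
      Real.exp (C ^ 2 / n) * Real.exp (-(n / 4) * ‖x‖ ^ 2) :=
    (integrable_exp_neg_mul_norm_sq (by positivity)).const_mul _
  refine lt_of_le_of_lt (lintegral_mono fun x => ?_)
    ((hasFiniteIntegral_iff_ofReal (Filter.Eventually.of_forall fun x => by positivity)).1 hint.2)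
  by_cases hx : x ∈ weylChamber n
  · rw [exp_neg_energy_of_mem hW hx, exp_neg_realEnergy_hermite hx]
    refine ENNReal.ofReal_le_ofReal ((mul_le_mul_of_nonneg_left (prod_rpow_sub_le hβ.le hx)
      (Real.exp_pos _).le).trans ?_)
    rw [← Real.exp_add, ← Real.exp_add]
    refine Real.exp_le_exp.2 ?_
    -- Completing the square: half of the Gaussian weight absorbs `e^{C|x|}`.
    have h : C ^ 2 / n + -(n / 4) * ‖x‖ ^ 2 - (-(n / 2 * ‖x‖ ^ 2) + C * ‖x‖) =
        (2 * C - n * ‖x‖) ^ 2 / (4 * n) := by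
      field_simp
      ring
    have h2 : 0 ≤ (2 * C - n * ‖x‖) ^ 2 / (4 * n) := by positivity
    linarith
  · simp [exp_neg_energy_of_notMem hW hx]

end

theorem corollary4 {n : ℕ} (hn : 0 < n) :
    (∀ (ρ : ℝ) (V : EuclideanSpace ℝ (Fin n) → ℝ) (W : ℝ → EReal),
      0 < ρ → StrongConvexOn Set.univ ρ V → IsInteractionPotential W →
      partitionFunction V W < ⊤ →
        IsProbabilityMeasure (gibbsMeasure V W) ∧
        GaussianConcentration hn ρ (gibbsMeasure V W)) ∧
    (∀ β : ℝ, 0 < β →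
      StrongConvexOn Set.univ (n : ℝ) (hermiteConfinement n) ∧
      IsInteractionPotential (logInteraction β) ∧
      partitionFunction (hermiteConfinement n) (logInteraction β) < ⊤ ∧
      gibbsMeasure (hermiteConfinement n) (logInteraction β) = betaHermite n β ∧
      IsProbabilityMeasure (betaHermite n β) ∧
      GaussianConcentration hn (n : ℝ) (betaHermite n β)) := by
  have main : ∀ (ρ : ℝ) (V : EuclideanSpace ℝ (Fin n) → ℝ) (W : ℝ → EReal),
      0 < ρ → StrongConvexOn Set.univ ρ V → IsInteractionPotential W →
      partitionFunction V W < ⊤ →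
        IsProbabilityMeasure (gibbsMeasure V W) ∧
        GaussianConcentration hn ρ (gibbsMeasure V W) := by
    intro ρ V W hρ hV hW hZ
    have hprob := isProbabilityMeasure_gibbsMeasure (hV.continuous hρ.le) hW hZ
    exact ⟨hprob, (maureyProperty_gibbsMeasure hρ.le hV hW hZ).gaussianConcentration hn hρ⟩
  refine ⟨main, fun β hβ => ?_⟩
  have hV := strongConvexOn_hermiteConfinement n
  have hW := isInteractionPotential_logInteraction hβ
  have hZ := partitionFunction_hermite_lt_top hn hβ
  have h := main n _ _ (by exact_mod_cast hn) hV hW hZ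
  rw [gibbsMeasure_hermite_eq hβ] at h
  exact ⟨hV, hW, hZ, gibbsMeasure_hermite_eq hβ, h.1, h.2⟩
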